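/- Let $(\Omega,\mu)$ be a $\sigma$-finite non-atomic measure space and let $\mathcal M(\Omega,\mu)$ be the set of (classes of $\mu$-a.e. equal) real- or complex-valued $\mu$-measurable functions on $\Omega$. For $f\in\mathcal M(\Omega,\mu)$ and $t>0$ put $f^*(t)=\inf\{\lambda\ge 0:\mu\{|f|>\lambda\}\le t\}$ and $f^{**}(t)=\frac1t\int_0^t f^*(u)\,du$ (values in $[0,\infty]$). The space $L_{1,\infty}$ consists of all $f$ with $\|f\|_{L_{1,\infty}}=\sup_{t>0}tf^*(t)<\infty$. For quasi-normed spaces $A_0,A_1\subset\mathcal M(\Omega,\mu)$ and $f\in A_0+A_1$ let $$K(t,f;A_0,A_1)=\inf\{\|f_0\|_{A_0}+t\|f_1\|_{A_1}: f=f_0+f_1,\ f_i\in A_i\},\qquad t>0.$$ A positive Lebesgue measurable function $b$ on $(0,\infty)$ is slowly varying, $b\in SV$, if for every $\varepsilon>0$ the function $t^{\varepsilon}b(t)$ is equivalent (up to positive multiplicative constants) to a non-decreasing function and $t^{-\varepsilon}b(t)$ is equivalent to a non-increasing function. Denote by $\|\cdot\|_{q,I}$ the usual (quasi-)norm of $L_q$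 on the interval $I$ with respect to Lebesgue measure, and put $1/\infty=0$, $1/0=\infty$. For $\alpha\in\mathbb R$, $0<q,r,s\le\infty$, $a,b,c\in SV$ and a measurable function $\varphi:(0,\infty)\to[0,\infty]$ let $$N^{\mathcal R,\mathcal L}_{\alpha}(\varphi)=\bigg\|t^{-\frac1s}c(t)\Big\|u^{-\frac1r}b(u)\big\|v^{\alpha-\frac1q}a(v)\varphi(v)\big\|_{q,(u,t)}\Big\|_{r,(0,t)}\bigg\|_{s,(0,\infty)},$$ $$N^{\mathcal L,\mathcal R}_{\alpha}(\varphi)=\bigg\|t^{-\frac1s}c(t)\Big\|u^{-\frac1r}b(u)\big\|v^{\alpha-\frac1q}a(v)\varphi(v)\big\|_{q,(t,u)}\Big\|_{r,(t,\infty)}\bigg\|_{s,(0,\infty)}.$$ For $\mathcal X\in\{(\mathcal R,\mathcal L),(\mathcal L,\mathcal R)\}$, $0\le\theta\le1$ and $0<p\le\infty$ define: - $(A_0,A_1)^{\mathcal X}_{\theta,s,c,r,b,q,a}$: all $f\in A_0+A_1$ with $N^{\mathcal X}_{-\theta}(K(\cdot,f;A_0,A_1))<\infty$; - $L^{\mathcal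 X}_{p,(s,c,r,b,q,a)}$: all $f\in\mathcal M(\Omega,\mu)$ with $N^{\mathcal X}_{1/p}(f^{*})<\infty$; - $(L)^{\mathcal X}_{p,(s,c,r,b,q,a)}$: all $f\in\mathcal M(\Omega,\mu)$ with $N^{\mathcal X}_{1/p}(f^{**})<\infty$; each with the indicated expression as its quasi-norm. Equality of two such spaces means that they have the same elements and that their quasi-norms are equivalent, i.e. each is at most a constant, independent of $f$, times the other. **Theorem.** Let $0<\theta\le1$, $p=\frac1{1-\theta}$, $0<q,r,s\le\infty$ and $a,b,c\in SV$. Then $$(L_1,L_\infty)^{\mathcal R,\mathcal L}_{\theta,s,c,r,b,q,a}=(L_{1,\infty},L_\infty)^{\mathcal R,\mathcal L}_{\theta,s,c,r,b,q,a}=(L)^{\mathcal R,\mathcal L}_{p,(s,c,r,b,q,a)}=L^{\mathcal R,\mathcal L}_{p,(s,c,r,b,q,a)}$$ and $$(L_1,L_\infty)^{\mathcal L,\mathcal R}_{\theta,s,c,r,b,q,a}=(L_{1,\infty},L_\infty)^{\mathcal L,\mathcal R}_{\theta,s,c,r,b,q,a}=(L)^{\mathcal L,\mathcal R}_{p,(s,c,r,b,q,a)}=L^{\mathcal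 L,\mathcal R}_{p,(s,c,r,b,q,a)}.$$ -/

import Mathlib

open MeasureTheory Set
open scoped ENNReal NNReal

namespace LorentzKaramata

/-- Slowly varying functions on `(0,∞)`: `b` is positive and Lebesgue measurable on `(0,∞)` and, for
each `ε > 0`, `t ^ ε * b t` is equivalent to a non-decreasing function and `t ^ (-ε) * b t` is
equivalent to a non-increasing function on `(0,∞)`. -/
structure IsSV (b : ℝ → ℝ) : Prop where
  pos : ∀ t, 0 < t → 0 < b t
  aemeasurable : AEMeasurable b (volume.restrict (Ioi 0))
  equiv_incr : ∀ ε : ℝ, 0 < ε → ∃ g : ℝ → ℝ, MonotoneOn g (Ioi 0) ∧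
    ∃ C : ℝ, 0 < C ∧ ∀ t, 0 < t → C⁻¹ * g t ≤ t ^ ε * b t ∧ t ^ ε * b t ≤ C * g t
  equiv_decr : ∀ ε : ℝ, 0 < ε → ∃ g : ℝ → ℝ, AntitoneOn g (Ioi 0) ∧
    ∃ C : ℝ, 0 < C ∧ ∀ t, 0 < t → C⁻¹ * g t ≤ t ^ (-ε) * b t ∧ t ^ (-ε) * b t ≤ C * g t

/-- Every measurable set of positive measure contains a measurable set of strictly smaller, positive
measure. -/
def Nonatomic {Ω : Type*} [MeasurableSpace Ω] (μ : Measure Ω) : Prop :=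
  ∀ A : Set Ω, MeasurableSet A → 0 < μ A →
    ∃ B : Set Ω, MeasurableSet B ∧ B ⊆ A ∧ 0 < μ B ∧ μ B < μ A

section Spaces

/-- A space of elements of `V`: the set of its elements together with its quasi-norm. -/
structure Space (V : Type*) where
  carrier : Set V
  qnorm : V → ℝ≥0∞

variable {V : Type*}

/-- The space of all elements at which `N` is finite, with the quasi-norm `N`. -/
def Space.ofNorm (N : V → ℝ≥0∞) : Space V where
  carrier := {f | N f < ∞}
  qnorm := N

/-- Continuous embedding `X ⊂ Y`. -/
def Space.Embeds (X Y : Space V) : Prop :=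
  X.carrier ⊆ Y.carrier ∧ ∃ C : ℝ≥0, ∀ f ∈ X.carrier, Y.qnorm f ≤ C * X.qnorm f

/-- Equality of spaces: the same elements and equivalent quasi-norms. -/
def Space.Same (X Y : Space V) : Prop := X.Embeds Y ∧ Y.Embeds X

/-- The elements of `A₀ + A₁`. -/
def sumCarrier [Add V] (A₀ A₁ : Space V) : Set V :=
  {f | ∃ f₀ ∈ A₀.carrier, ∃ f₁ ∈ A₁.carrier, f = f₀ + f₁}

/-- Peetre's `K`-functional `K(t,f;A₀,A₁)`. -/
noncomputable def K [Add V] (A₀ A₁ : Space V) (f : V) (t : ℝ) : ℝ≥0∞ :=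
  ⨅ (f₀ ∈ A₀.carrier) (f₁ ∈ A₁.carrier) (_ : f = f₀ + f₁),
    A₀.qnorm f₀ + ENNReal.ofReal t * A₁.qnorm f₁

end Spaces

section WeightedNorms

/-- `‖ t ^ (α - 1/q) w(t) φ(t) ‖_{q, I}`, the (quasi-)norm in `L_q` on the interval `I ⊆ (0,∞)`. -/
noncomputable def wNorm (α : ℝ) (q : ℝ≥0∞) (w : ℝ → ℝ) (φ : ℝ → ℝ≥0∞) (I : Set ℝ) : ℝ≥0∞ :=
  eLpNorm (fun t => ENNReal.ofReal (t ^ (α - (1 / q).toReal) * w t) * φ t) q (volume.restrict I)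

/-- `‖ t^(-1/s) c(t) ‖ u^(-1/r) b(u) ‖ v^(α-1/q) a(v) φ(v) ‖_{q,(u,t)} ‖_{r,(0,t)} ‖_{s,(0,∞)}` -/
noncomputable def normRL (α : ℝ) (s : ℝ≥0∞) (c : ℝ → ℝ) (r : ℝ≥0∞) (b : ℝ → ℝ)
    (q : ℝ≥0∞) (a : ℝ → ℝ) (φ : ℝ → ℝ≥0∞) : ℝ≥0∞ :=
  wNorm 0 s c (fun t => wNorm 0 r b (fun u => wNorm α q a φ (Ioo u t)) (Ioo 0 t)) (Ioi 0)

/-- `‖ t^(-1/s) c(t) ‖ u^(-1/r) b(u) ‖ v^(α-1/q) a(v) φ(v) ‖_{q,(t,u)} ‖_{r,(t,∞)} ‖_{s,(0,∞)}` -/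
noncomputable def normLR (α : ℝ) (s : ℝ≥0∞) (c : ℝ → ℝ) (r : ℝ≥0∞) (b : ℝ → ℝ)
    (q : ℝ≥0∞) (a : ℝ → ℝ) (φ : ℝ → ℝ≥0∞) : ℝ≥0∞ :=
  wNorm 0 s c (fun t => wNorm 0 r b (fun u => wNorm α q a φ (Ioo t u)) (Ioi t)) (Ioi 0)

end WeightedNorms

section Interpolation

variable {V : Type*} [Add V]

/-- The extremal interpolation space `(A₀,A₁)^{R,L}_{θ,s,c,r,b,q,a}`. -/
noncomputable def interpRL (A₀ A₁ : Space V) (θ : ℝ) (s : ℝ≥0∞) (c : ℝ → ℝ) (r : ℝ≥0∞)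
    (b : ℝ → ℝ) (q : ℝ≥0∞) (a : ℝ → ℝ) : Space V where
  carrier := {f | f ∈ sumCarrier A₀ A₁ ∧ normRL (-θ) s c r b q a (K A₀ A₁ f) < ∞}
  qnorm f := normRL (-θ) s c r b q a (K A₀ A₁ f)

/-- The extremal interpolation space `(A₀,A₁)^{L,R}_{θ,s,c,r,b,q,a}`. -/
noncomputable def interpLR (A₀ A₁ : Space V) (θ : ℝ) (s : ℝ≥0∞) (c : ℝ → ℝ) (r : ℝ≥0∞)
    (b : ℝ → ℝ) (q : ℝ≥0∞) (a : ℝ → ℝ) : Space V where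
  carrier := {f | f ∈ sumCarrier A₀ A₁ ∧ normLR (-θ) s c r b q a (K A₀ A₁ f) < ∞}
  qnorm f := normLR (-θ) s c r b q a (K A₀ A₁ f)

end Interpolation

section FunctionSpaces

variable {Ω : Type*} [MeasurableSpace Ω] {μ : Measure Ω} {𝕜 : Type*} [RCLike 𝕜]

/-- The non-increasing rearrangement `f*(t) = inf {l ≥ 0 : μ {|f| > l} ≤ t}`. -/
noncomputable def rearr (f : Ω →ₘ[μ] 𝕜) (t : ℝ) : ℝ≥0∞ :=
  sInf {l : ℝ≥0∞ | μ {x | l < ‖f x‖ₑ} ≤ ENNReal.ofReal t}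

/-- The maximal function `f**(t) = (1/t) ∫₀ᵗ f*(u) du` of `f*`. -/
noncomputable def maximal (f : Ω →ₘ[μ] 𝕜) (t : ℝ) : ℝ≥0∞ :=
  (ENNReal.ofReal t)⁻¹ * ∫⁻ u in Ioo 0 t, rearr f u

variable (μ 𝕜)

/-- `L_1`. -/
noncomputable def L1 : Space (Ω →ₘ[μ] 𝕜) := Space.ofNorm fun f => eLpNorm f 1 μ

/-- `L_∞`. -/
noncomputable def Linf : Space (Ω →ₘ[μ] 𝕜) := Space.ofNorm fun f => eLpNorm f ∞ μ

/-- `L_{1,∞}`, with the quasi-norm `sup_{t > 0} t f*(t)`. -/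
noncomputable def weakL1 : Space (Ω →ₘ[μ] 𝕜) :=
  Space.ofNorm fun f => ⨆ t ∈ Ioi (0 : ℝ), ENNReal.ofReal t * rearr f t

/-- The Lorentz–Karamata space `L^{R,L}_{p,(s,c,r,b,q,a)}`, defined via `f*`. -/
noncomputable def starRL (p s : ℝ≥0∞) (c : ℝ → ℝ) (r : ℝ≥0∞) (b : ℝ → ℝ) (q : ℝ≥0∞) (a : ℝ → ℝ) :
    Space (Ω →ₘ[μ] 𝕜) :=
  Space.ofNorm fun f => normRL (1 / p).toReal s c r b q a (rearr f)

/-- The Lorentz–Karamata space `(L)^{R,L}_{p,(s,c,r,b,q,a)}`, defined via `f**`. -/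
noncomputable def dstarRL (p s : ℝ≥0∞) (c : ℝ → ℝ) (r : ℝ≥0∞) (b : ℝ → ℝ) (q : ℝ≥0∞) (a : ℝ → ℝ) :
    Space (Ω →ₘ[μ] 𝕜) :=
  Space.ofNorm fun f => normRL (1 / p).toReal s c r b q a (maximal f)

/-- The Lorentz–Karamata space `L^{L,R}_{p,(s,c,r,b,q,a)}`, defined via `f*`. -/
noncomputable def starLR (p s : ℝ≥0∞) (c : ℝ → ℝ) (r : ℝ≥0∞) (b : ℝ → ℝ) (q : ℝ≥0∞) (a : ℝ → ℝ) :
    Space (Ω →ₘ[μ] 𝕜) :=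
  Space.ofNorm fun f => normLR (1 / p).toReal s c r b q a (rearr f)

/-- The Lorentz–Karamata space `(L)^{L,R}_{p,(s,c,r,b,q,a)}`, defined via `f**`. -/
noncomputable def dstarLR (p s : ℝ≥0∞) (c : ℝ → ℝ) (r : ℝ≥0∞) (b : ℝ → ℝ) (q : ℝ≥0∞) (a : ℝ → ℝ) :
    Space (Ω →ₘ[μ] 𝕜) :=
  Space.ofNorm fun f => normLR (1 / p).toReal s c r b q a (maximal f)

end FunctionSpaces

end LorentzKaramata

open LorentzKaramata

/-!
Every `f` satisfies the chain
`t f*(t) ≤ K(t, f; L_{1,∞}, L_∞) ≤ K(t, f; L_1, L_∞) ≤ 2 ∫₀ᵗ f* = 2 t f**(t)`: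
the last inequality cuts `f` at the height `f*(t)`, the first one is `f*(t) ≤ f₀*(t) + ‖f₁‖_∞`.
All the quasi-norms are therefore equivalent as soon as that of `∫₀ᵗ φ` is dominated by that of
`t φ(t)` for non-increasing `φ`.

This Hardy inequality only uses that dilations `φ ↦ φ(l ·)` have arbitrarily small constants, which
is where `θ > 0` enters: slowly varying factors cost `l^(-ε)` each, against the gain `l^θ`. The
truncated integrals `G_n(t) = ∫ φ` over `(l^n t, t)` satisfy `G_{n+1}(t) ≤ G_n(lt) + t φ(lt)`. For
`l` with a small enough dilation constant this bounds their quasi-norms uniformly in `n`, even if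
the quasi-norm is subadditive only up to a constant, and the Fatou property lets `n → ∞`.
-/

namespace LorentzKaramata

section WeightedNorm

variable {q : ℝ≥0∞} {w : ℝ → ℝ≥0∞} {F G : ℝ → ℝ≥0∞} {I J : Set ℝ}

/-- The weighted `L_q` quasi-norm `‖w F‖_{q,I}`; `wNorm α q w` is its instance for the weight
`t ^ (α - 1/q) * w t`. -/
noncomputable def weightedNorm (q : ℝ≥0∞) (w F : ℝ → ℝ≥0∞) (I : Set ℝ) : ℝ≥0∞ :=
  eLpNorm (fun t => w t * F t) q (volume.restrict I)

lemma weightedNorm_mono_set (h : I ⊆ J) : weightedNorm q w F I ≤ weightedNorm q w F J :=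
  eLpNorm_mono_measure _ (Measure.restrict_mono h le_rfl)

lemma weightedNorm_mono (hI : MeasurableSet I) (h : ∀ t ∈ I, F t ≤ G t) :
    weightedNorm q w F I ≤ weightedNorm q w G I :=
  eLpNorm_mono_enorm_ae <| ae_restrict_of_forall_mem hI fun t ht => mul_le_mul_right (h t ht) _

lemma weightedNorm_le_mul (hI : MeasurableSet I) {C : ℝ≥0} (h : ∀ t ∈ I, F t ≤ C * G t) :
    weightedNorm q w F I ≤ C * weightedNorm q w G I := by
  refine eLpNorm_le_nnreal_smul_eLpNorm_of_ae_le_mul' ?_ q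
  refine ae_restrict_of_forall_mem hI fun t ht => ?_
  simp only [enorm_eq_self]
  rw [mul_left_comm]
  exact mul_le_mul_right (h t ht) _

lemma weightedNorm_congr_weight {v : ℝ → ℝ≥0∞} (hI : MeasurableSet I)
    (h : ∀ t ∈ I, v t * F t = w t * G t) : weightedNorm q v F I = weightedNorm q w G I :=
  eLpNorm_congr_ae <| ae_restrict_of_forall_mem hI h

lemma weightedNorm_eq_top (hq : 0 < q) (hI : IsOpen I) (hne : I.Nonempty)
    (hw : ∀ t ∈ I, 0 < w t) (hF : ∀ t ∈ I, F t = ∞) : weightedNorm q w F I = ∞ := by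
  have hμ : volume.restrict I ≠ 0 := by
    simpa only [ne_eq, Measure.restrict_eq_zero] using (hI.measure_pos volume hne).ne'
  have hconst : weightedNorm q w F I = eLpNorm (fun _ => (∞ : ℝ≥0∞)) q (volume.restrict I) := by
    refine eLpNorm_congr_ae (ae_restrict_of_forall_mem hI.measurableSet fun t ht => ?_)
    simp only [hF t ht, ENNReal.mul_top (hw t ht).ne']
  rw [hconst, eLpNorm_const _ hq.ne' hμ, enorm_eq_self]
  refine ENNReal.top_mul fun h => ?_
  rcases ENNReal.rpow_eq_zero_iff.1 h with ⟨h, -⟩ | ⟨-, h⟩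
  · exact hμ (Measure.measure_univ_eq_zero.1 h)
  · exact absurd h (not_lt.2 (by positivity))

lemma weightedNorm_add_le (hw : AEMeasurable w (volume.restrict I)) (hF : Measurable F)
    (hG : Measurable G) :
    weightedNorm q w (fun t => F t + G t) I ≤
      ENNReal.LpAddConst q * (weightedNorm q w F I + weightedNorm q w G I) := by
  have h := eLpNorm_add_le' (p := q) (hw.mul hF.aemeasurable).aestronglyMeasurable
    (hw.mul hG.aemeasurable).aestronglyMeasurable
  rwa [← mul_add] at h

lemma eLpNorm_iSup_le {X : Type*} [MeasurableSpace X] {ν : Measure X} (q : ℝ≥0∞)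
    {F : ℕ → X → ℝ≥0∞} (hF : ∀ n, AEMeasurable (F n) ν)
    (hmono : ∀ᵐ x ∂ν, Monotone fun n => F n x) :
    eLpNorm (fun x => ⨆ n, F n x) q ν ≤ ⨆ n, eLpNorm (F n) q ν := by
  rcases eq_or_ne q 0 with rfl | hq
  · simp
  rcases eq_or_ne q ∞ with rfl | hq'
  · simp only [eLpNorm_exponent_top, eLpNormEssSup, enorm_eq_self]
    refine essSup_le_of_ae_le _ ?_
    filter_upwards [ae_all_iff.2 fun n => ENNReal.ae_le_essSup (μ := ν) (F n)] with x hx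
    exact iSup_mono hx
  · have hpos : 0 < q.toReal := ENNReal.toReal_pos hq hq'
    have rpow_iSup : ∀ {s : ℝ}, 0 < s → ∀ y : ℕ → ℝ≥0∞, (⨆ n, y n) ^ s = ⨆ n, y n ^ s :=
      fun hs y => (ENNReal.orderIsoRpow _ hs).map_iSup y
    simp only [eLpNorm_eq_lintegral_rpow_enorm_toReal hq hq', enorm_eq_self, rpow_iSup hpos]
    rw [lintegral_iSup' (fun n => (hF n).pow_const _) (hmono.mono fun x hx m n hmn =>
      ENNReal.rpow_le_rpow (hx hmn) hpos.le), rpow_iSup (one_div_pos.2 hpos)]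

lemma weightedNorm_iSup_le (hw : AEMeasurable w (volume.restrict I)) (hI : MeasurableSet I)
    {F : ℕ → ℝ → ℝ≥0∞} (hF : ∀ n, Measurable (F n)) (hmono : ∀ t ∈ I, Monotone fun n => F n t) :
    weightedNorm q w (fun t => ⨆ n, F n t) I ≤ ⨆ n, weightedNorm q w (F n) I := by
  simpa only [weightedNorm, ENNReal.mul_iSup] using
    eLpNorm_iSup_le (F := fun n t => w t * F n t) q (fun n => hw.mul (hF n).aemeasurable) <|
      ae_restrict_of_forall_mem hI fun t ht _ _ hmn => mul_le_mul_right (hmono t ht hmn) (w t)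

lemma weightedNorm_comp_mul_left (q : ℝ≥0∞) (w F : ℝ → ℝ≥0∞) (I : Set ℝ) {l : ℝ≥0} (hl : 0 < l) :
    weightedNorm q (fun t => w (l * t)) (fun t => F (l * t)) ((fun t : ℝ => l * t) ⁻¹' I) =
      (l ^ (-(1 / q).toReal) : ℝ≥0) * weightedNorm q w F I := by
  have hl' : (l : ℝ) ≠ 0 := by positivity
  have hemb : MeasurableEmbedding fun t : ℝ => l * t := measurableEmbedding_mulLeft₀ hl'
  have hscale : ENNReal.ofReal |(l : ℝ)⁻¹| = (l⁻¹ : ℝ≥0) := by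
    rw [← NNReal.coe_inv, NNReal.abs_eq, ENNReal.ofReal_coe_nnreal]
  change eLpNorm ((fun t => w t * F t) ∘ fun t : ℝ => l * t) q _ = _
  rw [← hemb.eLpNorm_map_measure, ← hemb.restrict_map, Real.map_volume_mul_left hl',
    Measure.restrict_smul, hscale, eLpNorm_smul_measure_of_ne_zero (by simpa using hl.ne'),
    ← ENNReal.coe_rpow_of_ne_zero (inv_ne_zero hl.ne'), NNReal.inv_rpow, ← NNReal.rpow_neg,
    smul_eq_mul, weightedNorm]

end WeightedNorm

section Weight

/-- Positive measurable weights on `(0,∞)` whose dilations satisfy `w(t) ≤ C l^(-β) w(l t)` for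
`0 < l ≤ 1`; every `t ^ α * b t` with `b` slowly varying is one for all `β > α`. -/
structure IsWeight (w : ℝ → ℝ≥0∞) (β : ℝ) : Prop where
  pos : ∀ t, 0 < t → 0 < w t
  aemeasurable : AEMeasurable w (volume.restrict (Ioi 0))
  le_dilate : ∃ C : ℝ≥0, ∀ l : ℝ≥0, 0 < l → l ≤ 1 → ∀ t, 0 < t →
    w t ≤ (C * l ^ (-β) : ℝ≥0) * w (l * t)

lemma IsSV.le_dilate {b : ℝ → ℝ} (hb : IsSV b) {ε : ℝ} (hε : 0 < ε) :
    ∃ C : ℝ≥0, ∀ l : ℝ≥0, 0 < l → l ≤ 1 → ∀ t, 0 < t → b t ≤ C * l ^ (-ε) * b (l * t) := by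
  obtain ⟨g, hg, C, hC, h⟩ := hb.equiv_decr ε hε
  lift C to ℝ≥0 using hC.le
  refine ⟨C * C, fun l hl hl1 t ht => ?_⟩
  have hlt : 0 < l * t := by positivity
  have hg_le : g t ≤ g (l * t) := hg hlt ht (mul_le_of_le_one_left ht.le (mod_cast hl1))
  have hg_le' : g (l * t) ≤ C * ((l * t) ^ (-ε) * b (l * t)) :=
    (inv_mul_le_iff₀ hC).1 (h _ hlt).1
  refine le_of_mul_le_mul_left ?_ (Real.rpow_pos_of_pos ht (-ε))
  calc t ^ (-ε) * b t ≤ C * g t := (h t ht).2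
    _ ≤ C * (C * ((l * t) ^ (-ε) * b (l * t))) := by gcongr; exact hg_le.trans hg_le'
    _ = t ^ (-ε) * ((C * C : ℝ≥0) * l ^ (-ε) * b (l * t)) := by
      rw [Real.mul_rpow l.coe_nonneg ht.le]
      push_cast
      ring

lemma IsSV.isWeight {b : ℝ → ℝ} (hb : IsSV b) (α : ℝ) {ε : ℝ} (hε : 0 < ε) :
    IsWeight (fun t => ENNReal.ofReal (t ^ α * b t)) (α + ε) where
  pos t ht := ENNReal.ofReal_pos.2 (mul_pos (Real.rpow_pos_of_pos ht α) (hb.pos t ht))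
  aemeasurable :=
    ((measurable_id.pow_const α).aemeasurable.mul hb.aemeasurable).ennreal_ofReal
  le_dilate := by
    obtain ⟨C, hC⟩ := hb.le_dilate hε
    refine ⟨C, fun l hl hl1 t ht => ?_⟩
    rw [← ENNReal.ofReal_coe_nnreal, ← ENNReal.ofReal_mul (NNReal.coe_nonneg _)]
    refine ENNReal.ofReal_le_ofReal ?_
    calc t ^ α * b t ≤ t ^ α * (C * l ^ (-ε) * b (l * t)) := by gcongr; exact hC l hl hl1 t ht
      _ = C * (l ^ (-(α + ε)) * l ^ α) * t ^ α * b (l * t) := by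
        rw [← Real.rpow_add (by positivity), show -(α + ε) + α = -ε by ring]
        ring
      _ = (C * l ^ (-(α + ε)) : ℝ≥0) * ((l * t) ^ α * b (l * t)) := by
        rw [Real.mul_rpow l.coe_nonneg ht.le]
        push_cast
        ring

variable {w : ℝ → ℝ≥0∞} {β : ℝ} {I : Set ℝ}

lemma IsWeight.aemeasurable_restrict (hw : IsWeight w β) (hI : I ⊆ Ioi 0) :
    AEMeasurable w (volume.restrict I) :=
  hw.aemeasurable.mono_measure (Measure.restrict_mono hI le_rfl)

lemma IsWeight.weightedNorm_dilate_le (hw : IsWeight w β) (q : ℝ≥0∞) :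
    ∃ C : ℝ≥0, ∀ l : ℝ≥0, 0 < l → l ≤ 1 → ∀ (F G : ℝ → ℝ≥0∞) (I : Set ℝ) (D : ℝ≥0),
      I ⊆ Ioi 0 → MeasurableSet I → (∀ t : ℝ, l * t ∈ I → F t ≤ D * G (l * t)) →
      weightedNorm q w F ((fun t : ℝ => l * t) ⁻¹' I) ≤
        (D * (C * l ^ (-(β + (1 / q).toReal))) : ℝ≥0) * weightedNorm q w G I := by
  obtain ⟨C, hC⟩ := hw.le_dilate
  refine ⟨C, fun l hl hl1 F G I D hI hIm hFG => ?_⟩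
  have hl' : (0 : ℝ) < l := mod_cast hl
  have hpointwise : ∀ t ∈ (fun t : ℝ => l * t) ⁻¹' I,
      w t * F t ≤ (D * (C * l ^ (-β)) : ℝ≥0) * (w (l * t) * G (l * t)) := fun t ht =>
    calc w t * F t ≤ ((C * l ^ (-β) : ℝ≥0) * w (l * t)) * (D * G (l * t)) :=
          mul_le_mul' (hC l hl hl1 t ((mul_pos_iff_of_pos_left hl').1 (hI ht))) (hFG t ht)
      _ = _ := by push_cast; ring
  calc weightedNorm q w F ((fun t : ℝ => l * t) ⁻¹' I)
      ≤ (D * (C * l ^ (-β)) : ℝ≥0) * weightedNorm q (fun t => w (l * t)) (fun t => G (l * t))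
          ((fun t : ℝ => l * t) ⁻¹' I) :=
        eLpNorm_le_nnreal_smul_eLpNorm_of_ae_le_mul'
          (ae_restrict_of_forall_mem (measurable_const_mul (l : ℝ) hIm) hpointwise) q
    _ = (D * (C * l ^ (-(β + (1 / q).toReal))) : ℝ≥0) * weightedNorm q w G I := by
        rw [weightedNorm_comp_mul_left q w G I hl, ← mul_assoc, ← ENNReal.coe_mul, neg_add,
          NNReal.rpow_add hl.ne']
        ring_nf

end Weight


section FunctionQuasinorm

/-- Quasi-norms on functions `(0,∞) → [0,∞]` with quasi-triangle constant `κ` and the Fatou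
property, infinite at the constant `∞`. The triangle inequality and the Fatou property are only
asked of measurable functions, as they fail for the integrals of others. -/
structure IsFunctionQuasinorm (κ : ℝ≥0) (N : (ℝ → ℝ≥0∞) → ℝ≥0∞) : Prop where
  le_mul : ∀ (C : ℝ≥0) (φ ψ : ℝ → ℝ≥0∞), (∀ t, 0 < t → φ t ≤ C * ψ t) → N φ ≤ C * N ψ
  add_le : ∀ φ ψ : ℝ → ℝ≥0∞, Measurable φ → Measurable ψ →
    N (fun t => φ t + ψ t) ≤ κ * (N φ + N ψ)
  iSup_le : ∀ φ : ℕ → ℝ → ℝ≥0∞, (∀ n, Measurable (φ n)) →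
    (∀ t, 0 < t → Monotone fun n => φ n t) → N (fun t => ⨆ n, φ n t) ≤ ⨆ n, N (φ n)
  top : N (fun _ => ∞) = ∞

lemma IsFunctionQuasinorm.mono {κ : ℝ≥0} {N : (ℝ → ℝ≥0∞) → ℝ≥0∞} (hN : IsFunctionQuasinorm κ N)
    {φ ψ : ℝ → ℝ≥0∞} (h : ∀ t, 0 < t → φ t ≤ ψ t) : N φ ≤ N ψ := by
  simpa using hN.le_mul 1 φ ψ (by simpa using h)

lemma isFunctionQuasinorm_eval {t : ℝ} (ht : 0 < t) : IsFunctionQuasinorm 1 fun φ => φ t where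
  le_mul _ _ _ h := h t ht
  add_le _ _ _ _ := by simp
  iSup_le _ _ _ := le_rfl
  top := rfl

lemma IsFunctionQuasinorm.weightedNorm {κ : ℝ≥0} {q : ℝ≥0∞} {w : ℝ → ℝ≥0∞} {I : Set ℝ}
    {N : ℝ → (ℝ → ℝ≥0∞) → ℝ≥0∞} (hN : ∀ t ∈ I, IsFunctionQuasinorm κ (N t))
    (hmeas : ∀ φ, Measurable φ → Measurable fun t => N t φ) (hq : 0 < q) (hI : IsOpen I)
    (hne : I.Nonempty) (hw : AEMeasurable w (volume.restrict I)) (hpos : ∀ t ∈ I, 0 < w t) :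
    IsFunctionQuasinorm (κ * (ENNReal.LpAddConst q).toNNReal)
      fun φ => weightedNorm q w (fun t => N t φ) I where
  le_mul C φ ψ h := weightedNorm_le_mul hI.measurableSet fun t ht => (hN t ht).le_mul C φ ψ h
  add_le φ ψ hφ hψ := by
    rw [ENNReal.coe_mul, ENNReal.coe_toNNReal (ENNReal.LpAddConst_lt_top q).ne, mul_assoc]
    exact (weightedNorm_le_mul hI.measurableSet fun t ht => (hN t ht).add_le φ ψ hφ hψ).trans <|
      mul_le_mul_right (weightedNorm_add_le hw (hmeas φ hφ) (hmeas ψ hψ)) _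
  iSup_le φ hφ hmono :=
    (weightedNorm_mono hI.measurableSet fun t ht => (hN t ht).iSup_le φ hφ hmono).trans <|
      weightedNorm_iSup_le hw hI.measurableSet (fun n => hmeas _ (hφ n)) fun t ht _ _ hmn =>
        (hN t ht).mono fun x hx => hmono x hx hmn
  top := weightedNorm_eq_top hq hI hne hpos fun t ht => (hN t ht).top

end FunctionQuasinorm

section KParameter

variable {Φ : (ℝ → ℝ≥0∞) → ℝ≥0∞}

/-- The parameters of the real method considered here: function quasi-norms for which the dilations
`φ ↦ φ (l ·)` are contractions with arbitrarily small constants. -/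
structure IsKParameter (Φ : (ℝ → ℝ≥0∞) → ℝ≥0∞) : Prop where
  isFunctionQuasinorm : ∃ κ, IsFunctionQuasinorm κ Φ
  dilate_le : ∀ δ : ℝ≥0, 0 < δ → ∃ l : ℝ≥0, 0 < l ∧ l < 1 ∧
    ∀ φ : ℝ → ℝ≥0∞, Φ (fun t => φ (l * t)) ≤ δ * Φ φ

lemma measurable_setLIntegral_Ioo {φ : ℝ → ℝ≥0∞} (hφ : Measurable φ) (c : ℝ) :
    Measurable fun t => ∫⁻ u in Ioo (c * t) t, φ u := by
  simp only [← lintegral_indicator measurableSet_Ioo]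
  refine Measurable.lintegral_prod_right' (f := fun p : ℝ × ℝ =>
    {p : ℝ × ℝ | c * p.1 < p.2 ∧ p.2 < p.1}.indicator (fun p => φ p.2) p) ?_
  refine (hφ.comp measurable_snd).indicator (MeasurableSet.inter ?_ ?_)
  · exact measurableSet_lt (measurable_fst.const_mul c) measurable_snd
  · exact measurableSet_lt measurable_snd measurable_fst

lemma setLIntegral_Ioo_le_add {φ : ℝ → ℝ≥0∞} (hφ : Antitone φ) (a b c : ℝ) :
    ∫⁻ u in Ioo a b, φ u ≤ (∫⁻ u in Ioo a c, φ u) + ENNReal.ofReal (b - c) * φ c := by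
  have htail : ∫⁻ u in Ico c b, φ u ≤ ENNReal.ofReal (b - c) * φ c :=
    calc ∫⁻ u in Ico c b, φ u ≤ ∫⁻ _ in Ico c b, φ c :=
          setLIntegral_mono' measurableSet_Ico fun u hu => hφ hu.1
      _ = ENNReal.ofReal (b - c) * φ c := by rw [setLIntegral_const, Real.volume_Ico, mul_comm]
  have hcover : Ioo a b ⊆ Ioo a c ∪ Ico c b := fun u hu =>
    (lt_or_ge u c).imp (fun h => ⟨hu.1, h⟩) fun h => ⟨h, hu.2⟩
  exact (lintegral_mono_set hcover).trans <|
    (lintegral_union_le _ _ _).trans (add_le_add le_rfl htail)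

lemma setLIntegral_Ioo_pow_succ_le {φ : ℝ → ℝ≥0∞} (hφ : Antitone φ) {l : ℝ≥0} (hl : 0 < l)
    (n : ℕ) {t : ℝ} (ht : 0 < t) :
    ∫⁻ u in Ioo ((l : ℝ) ^ (n + 1) * t) t, φ u ≤
      (∫⁻ u in Ioo ((l : ℝ) ^ n * (l * t)) (l * t), φ u) +
        (l⁻¹ : ℝ≥0) * (ENNReal.ofReal (l * t) * φ (l * t)) := by
  have hrescale : ENNReal.ofReal t = (l⁻¹ : ℝ≥0) * ENNReal.ofReal (l * t) := by
    rw [← ENNReal.ofReal_coe_nnreal, ← ENNReal.ofReal_mul (NNReal.coe_nonneg _),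
      NNReal.coe_inv, inv_mul_cancel_left₀ (by positivity)]
  rw [← mul_assoc _ (ENNReal.ofReal _), ← hrescale, pow_succ, mul_assoc]
  refine (setLIntegral_Ioo_le_add hφ _ t (l * t)).trans ?_
  gcongr
  exact sub_le_self _ (by positivity)

lemma setLIntegral_Ioo_zero_eq_iSup (φ : ℝ → ℝ≥0∞) {l : ℝ} (hl0 : 0 < l) (hl1 : l < 1) {t : ℝ}
    (ht : 0 < t) : ∫⁻ u in Ioo 0 t, φ u = ⨆ n : ℕ, ∫⁻ u in Ioo (l ^ n * t) t, φ u := by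
  have hanti : Antitone fun n : ℕ => l ^ n * t := fun m n hmn =>
    mul_le_mul_of_nonneg_right (pow_le_pow_of_le_one hl0.le hl1.le hmn) ht.le
  have hunion : Ioo 0 t = ⋃ n : ℕ, Ioo (l ^ n * t) t := by
    ext u
    simp only [mem_iUnion, mem_Ioo, exists_and_right]
    refine and_congr_left fun _ => ⟨fun hu => ?_, fun ⟨n, hn⟩ => lt_trans (by positivity) hn⟩
    obtain ⟨n, hn⟩ := exists_pow_lt_of_lt_one (div_pos hu ht) hl1
    exact ⟨n, (lt_div_iff₀ ht).1 hn⟩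
  rw [hunion, setLIntegral_iUnion_of_directed]
  exact Monotone.directed_le fun m n hmn => Ioo_subset_Ioo_left (hanti hmn)

lemma IsKParameter.exists_forall_truncated_hardy (hΦ : IsKParameter Φ) :
    ∃ l : ℝ≥0, 0 < l ∧ l < 1 ∧ ∀ φ : ℝ → ℝ≥0∞, Antitone φ → ∀ n : ℕ,
      Φ (fun t => ∫⁻ u in Ioo ((l : ℝ) ^ n * t) t, φ u) ≤
        (l⁻¹ : ℝ≥0) * Φ (fun t => ENNReal.ofReal t * φ t) := by
  obtain ⟨κ, hκ⟩ := hΦ.isFunctionQuasinorm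
  obtain ⟨l, hl0, hl1, hl⟩ := hΦ.dilate_le (2 * (κ + 1))⁻¹ (by positivity)
  refine ⟨l, hl0, hl1, fun φ hφ n => ?_⟩
  have hhalf : (2 * (κ + 1))⁻¹ * (κ * (l⁻¹ + l⁻¹)) ≤ l⁻¹ :=
    calc (2 * (κ + 1))⁻¹ * (κ * (l⁻¹ + l⁻¹)) = κ / (κ + 1) * l⁻¹ := by field_simp; ring
      _ ≤ l⁻¹ := mul_le_of_le_one_left' (div_le_one_of_le₀ (by simp) (by positivity))
  set ψ : ℝ → ℝ≥0∞ := fun t => ENNReal.ofReal t * φ t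
  set G : ℕ → ℝ → ℝ≥0∞ := fun n t => ∫⁻ u in Ioo ((l : ℝ) ^ n * t) t, φ u
  have hψ : Measurable ψ := ENNReal.measurable_ofReal.mul hφ.measurable
  induction n with
  | zero => exact hκ.le_mul _ _ _ fun t _ => by simp
  | succ n ih =>
    calc Φ (G (n + 1)) ≤ Φ (fun t => G n (l * t) + (l⁻¹ : ℝ≥0) * ψ (l * t)) :=
          hκ.mono fun _ => setLIntegral_Ioo_pow_succ_le hφ hl0 n
      _ ≤ (2 * (κ + 1))⁻¹ * Φ (fun t => G n t + (l⁻¹ : ℝ≥0) * ψ t) :=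
          hl fun t => G n t + (l⁻¹ : ℝ≥0) * ψ t
      _ ≤ (2 * (κ + 1))⁻¹ * (κ * (Φ (G n) + Φ (fun t => (l⁻¹ : ℝ≥0) * ψ t))) := by
          gcongr
          exact hκ.add_le _ _ (measurable_setLIntegral_Ioo hφ.measurable _) (hψ.const_mul _)
      _ ≤ (2 * (κ + 1))⁻¹ * (κ * ((l⁻¹ : ℝ≥0) * Φ ψ + (l⁻¹ : ℝ≥0) * Φ ψ)) := by
          gcongr
          exact hκ.le_mul _ _ _ fun t _ => le_rfl
      _ = ((2 * (κ + 1))⁻¹ * (κ * (l⁻¹ + l⁻¹)) : ℝ≥0) * Φ ψ := by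
          push_cast
          ring
      _ ≤ (l⁻¹ : ℝ≥0) * Φ ψ := by gcongr

theorem IsKParameter.hardy (hΦ : IsKParameter Φ) :
    ∃ C : ℝ≥0, ∀ φ : ℝ → ℝ≥0∞, Antitone φ →
      Φ (fun t => ∫⁻ u in Ioo 0 t, φ u) ≤ C * Φ (fun t => ENNReal.ofReal t * φ t) := by
  obtain ⟨l, hl0, hl1, hl⟩ := hΦ.exists_forall_truncated_hardy
  obtain ⟨_, hκ⟩ := hΦ.isFunctionQuasinorm
  refine ⟨l⁻¹, fun φ hφ => ?_⟩
  calc Φ (fun t => ∫⁻ u in Ioo 0 t, φ u)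
      ≤ Φ (fun t => ⨆ n : ℕ, ∫⁻ u in Ioo ((l : ℝ) ^ n * t) t, φ u) :=
        hκ.mono fun t ht =>
          (setLIntegral_Ioo_zero_eq_iSup φ (mod_cast hl0) (mod_cast hl1) ht).le
    _ ≤ ⨆ n : ℕ, Φ (fun t => ∫⁻ u in Ioo ((l : ℝ) ^ n * t) t, φ u) :=
        hκ.iSup_le _ (fun n => measurable_setLIntegral_Ioo hφ.measurable _) fun t ht m n hmn =>
          lintegral_mono_set <| Ioo_subset_Ioo_left <|
            mul_le_mul_of_nonneg_right (pow_le_pow_of_le_one hl0.le hl1.le hmn) ht.le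
    _ ≤ (l⁻¹ : ℝ≥0) * Φ (fun t => ENNReal.ofReal t * φ t) := iSup_le (hl φ hφ)

end KParameter

section NestedNorm

/-- Families of intervals `J t` and `I t u`, `u ∈ J t`, that are compatible with dilations and
monotone in their parameters, such as `(0,t)` and `(u,t)`, or `(t,∞)` and `(t,u)`. -/
structure IsIntervalSystem (J : ℝ → Set ℝ) (I : ℝ → ℝ → Set ℝ) : Prop where
  isOpen_outer : ∀ t, IsOpen (J t)
  isOpen_inner : ∀ t u, IsOpen (I t u)
  outer_subset : ∀ t, 0 < t → J t ⊆ Ioi 0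
  inner_subset : ∀ t, 0 < t → ∀ u ∈ J t, I t u ⊆ Ioi 0
  outer_nonempty : ∀ t, 0 < t → (J t).Nonempty
  inner_nonempty : ∀ t, 0 < t → ∀ u ∈ J t, (I t u).Nonempty
  preimage_outer : ∀ l t : ℝ, 0 < l → (fun x => l * x) ⁻¹' J (l * t) = J t
  preimage_inner : ∀ l t u : ℝ, 0 < l → (fun x => l * x) ⁻¹' I (l * t) (l * u) = I t u
  monotone_or_antitone_inner : ∀ t, Monotone (I t) ∨ Antitone (I t)
  monotone_or_antitone : (Monotone J ∧ ∀ u, Monotone fun t => I t u) ∨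
    (Antitone J ∧ ∀ u, Antitone fun t => I t u)

lemma isIntervalSystem_RL : IsIntervalSystem (fun t => Ioo 0 t) (fun t u => Ioo u t) where
  isOpen_outer _ := isOpen_Ioo
  isOpen_inner _ _ := isOpen_Ioo
  outer_subset _ _ := Ioo_subset_Ioi_self
  inner_subset _ _ _ hu := Ioo_subset_Ioi_self.trans (Ioi_subset_Ioi hu.1.le)
  outer_nonempty _ := nonempty_Ioo.2
  inner_nonempty _ _ _ hu := nonempty_Ioo.2 hu.2
  preimage_outer l t hl := by
    ext x
    simp only [mem_preimage, mem_Ioo, mul_pos_iff_of_pos_left hl, mul_lt_mul_iff_right₀ hl]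
  preimage_inner l t u hl := by
    ext x
    simp only [mem_preimage, mem_Ioo, mul_lt_mul_iff_right₀ hl]
  monotone_or_antitone_inner _ := .inr fun _ _ => Ioo_subset_Ioo_left
  monotone_or_antitone := .inl
    ⟨fun _ _ => Ioo_subset_Ioo_right, fun _ _ _ => Ioo_subset_Ioo_right⟩

lemma isIntervalSystem_LR : IsIntervalSystem (fun t => Ioi t) (fun t u => Ioo t u) where
  isOpen_outer _ := isOpen_Ioi
  isOpen_inner _ _ := isOpen_Ioo
  outer_subset _ ht := Ioi_subset_Ioi ht.le
  inner_subset _ ht _ _ := Ioo_subset_Ioi_self.trans (Ioi_subset_Ioi ht.le)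
  outer_nonempty _ _ := nonempty_Ioi
  inner_nonempty _ _ _ hu := nonempty_Ioo.2 hu
  preimage_outer l t hl := by
    ext x
    simp only [mem_preimage, mem_Ioi, mul_lt_mul_iff_right₀ hl]
  preimage_inner l t u hl := by
    ext x
    simp only [mem_preimage, mem_Ioo, mul_lt_mul_iff_right₀ hl]
  monotone_or_antitone_inner _ := .inl fun _ _ => Ioo_subset_Ioo_right
  monotone_or_antitone := .inr ⟨fun _ _ => Ioi_subset_Ioi, fun _ _ _ => Ioo_subset_Ioo_left⟩

/-- The common form `‖C(t) ‖B(u) ‖A(v) φ(v)‖_{q, I t u}‖_{r, J t}‖_{s,(0,∞)}` of `normRL` and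
`normLR`. -/
noncomputable def nestedNorm (J : ℝ → Set ℝ) (I : ℝ → ℝ → Set ℝ) (s : ℝ≥0∞) (C : ℝ → ℝ≥0∞)
    (r : ℝ≥0∞) (B : ℝ → ℝ≥0∞) (q : ℝ≥0∞) (A : ℝ → ℝ≥0∞) (φ : ℝ → ℝ≥0∞) : ℝ≥0∞ :=
  weightedNorm s C (fun t => weightedNorm r B (fun u => weightedNorm q A φ (I t u)) (J t)) (Ioi 0)

variable {J : ℝ → Set ℝ} {I : ℝ → ℝ → Set ℝ} {s r q : ℝ≥0∞} {A B C : ℝ → ℝ≥0∞} {α β γ : ℝ}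

lemma IsIntervalSystem.measurable_inner (H : IsIntervalSystem J I) (φ : ℝ → ℝ≥0∞) (t : ℝ) :
    Measurable fun u => weightedNorm q A φ (I t u) := by
  rcases H.monotone_or_antitone_inner t with h | h
  · exact Monotone.measurable fun _ _ huv => weightedNorm_mono_set (h huv)
  · exact Antitone.measurable fun _ _ huv => weightedNorm_mono_set (h huv)

lemma IsIntervalSystem.measurable_outer (H : IsIntervalSystem J I) (φ : ℝ → ℝ≥0∞) :
    Measurable fun t => weightedNorm r B (fun u => weightedNorm q A φ (I t u)) (J t) := by
  have hle {t t' : ℝ} (hJ : J t ⊆ J t') (hI : ∀ u, I t u ⊆ I t' u) :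
      weightedNorm r B (fun u => weightedNorm q A φ (I t u)) (J t) ≤
        weightedNorm r B (fun u => weightedNorm q A φ (I t' u)) (J t') :=
    (weightedNorm_mono_set hJ).trans <|
      weightedNorm_mono (H.isOpen_outer t').measurableSet fun u _ => weightedNorm_mono_set (hI u)
  rcases H.monotone_or_antitone with ⟨hJ, hI⟩ | ⟨hJ, hI⟩
  · exact Monotone.measurable fun _ _ htt' => hle (hJ htt') fun u => hI u htt'
  · exact Antitone.measurable fun _ _ htt' => hle (hJ htt') fun u => hI u htt'

lemma IsIntervalSystem.nestedNorm_congr (H : IsIntervalSystem J I) {A' φ φ' : ℝ → ℝ≥0∞}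
    (h : ∀ t, 0 < t → A t * φ t = A' t * φ' t) :
    nestedNorm J I s C r B q A φ = nestedNorm J I s C r B q A' φ' :=
  weightedNorm_congr_weight measurableSet_Ioi fun t ht => congrArg (C t * ·) <|
    weightedNorm_congr_weight (H.isOpen_outer t).measurableSet fun u hu => congrArg (B u * ·) <|
      weightedNorm_congr_weight (H.isOpen_inner t u).measurableSet fun v hv =>
        h v (H.inner_subset t ht u hu hv)

lemma IsIntervalSystem.isFunctionQuasinorm (H : IsIntervalSystem J I) (hA : IsWeight A α)
    (hB : IsWeight B β) (hC : IsWeight C γ) (hq : 0 < q) (hr : 0 < r) (hs : 0 < s) :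
    ∃ κ, IsFunctionQuasinorm κ (nestedNorm J I s C r B q A) := by
  have hinner (t : ℝ) (ht : 0 < t) (u : ℝ) (hu : u ∈ J t) :=
    IsFunctionQuasinorm.weightedNorm (I := I t u) (w := A) (N := fun v φ => φ v)
      (fun v hv => isFunctionQuasinorm_eval (H.inner_subset t ht u hu hv)) (fun _ hφ => hφ) hq
      (H.isOpen_inner t u) (H.inner_nonempty t ht u hu)
      (hA.aemeasurable_restrict (H.inner_subset t ht u hu))
      fun v hv => hA.pos v (H.inner_subset t ht u hu hv)
  have hmiddle (t : ℝ) (ht : 0 < t) :=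
    IsFunctionQuasinorm.weightedNorm (hinner t ht) (fun φ _ => H.measurable_inner φ t) hr
      (H.isOpen_outer t) (H.outer_nonempty t ht) (hB.aemeasurable_restrict (H.outer_subset t ht))
      fun u hu => hB.pos u (H.outer_subset t ht hu)
  exact ⟨_, IsFunctionQuasinorm.weightedNorm hmiddle (fun φ _ => H.measurable_outer φ) hs
    isOpen_Ioi nonempty_Ioi hC.aemeasurable hC.pos⟩

lemma IsIntervalSystem.nestedNorm_dilate_le (H : IsIntervalSystem J I) (hA : IsWeight A α)
    (hB : IsWeight B β) (hC : IsWeight C γ) (q r s : ℝ≥0∞) :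
    ∃ M : ℝ≥0, ∀ l : ℝ≥0, 0 < l → l ≤ 1 → ∀ φ : ℝ → ℝ≥0∞,
      nestedNorm J I s C r B q A (fun t => φ (l * t)) ≤
        (M * l ^ (-((α + (1 / q).toReal) + (β + (1 / r).toReal) + (γ + (1 / s).toReal))) : ℝ≥0) *
          nestedNorm J I s C r B q A φ := by
  obtain ⟨a, ha⟩ := hA.weightedNorm_dilate_le q
  obtain ⟨b, hb⟩ := hB.weightedNorm_dilate_le r
  obtain ⟨c, hc⟩ := hC.weightedNorm_dilate_le s
  refine ⟨a * b * c, fun l hl hl1 φ => ?_⟩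
  have hl' : (0 : ℝ) < l := mod_cast hl
  have hinner (t u : ℝ) (ht : l * t ∈ Ioi (0 : ℝ)) (hu : l * u ∈ J (l * t)) :=
    H.preimage_inner l t u hl' ▸ ha l hl hl1 (fun v => φ (l * v)) φ (I (l * t) (l * u)) 1
      (H.inner_subset _ ht _ hu) (H.isOpen_inner _ _).measurableSet fun v _ => by simp
  have hmiddle (t : ℝ) (ht : l * t ∈ Ioi (0 : ℝ)) :=
    H.preimage_outer l t hl' ▸ hb l hl hl1 (fun u => weightedNorm q A (fun v => φ (l * v)) (I t u))
      (fun u => weightedNorm q A φ (I (l * t) u)) (J (l * t)) _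
      (H.outer_subset _ ht) (H.isOpen_outer _).measurableSet fun u hu => hinner t u ht hu
  have houter := hc l hl hl1
    (fun t => weightedNorm r B (fun u => weightedNorm q A (fun v => φ (l * v)) (I t u)) (J t))
    (fun t => weightedNorm r B (fun u => weightedNorm q A φ (I t u)) (J t)) (Ioi 0) _
    subset_rfl measurableSet_Ioi hmiddle
  have hpreimage : (fun t : ℝ => l * t) ⁻¹' Ioi 0 = Ioi 0 :=
    Set.ext fun t => mul_pos_iff_of_pos_left hl'
  rw [hpreimage] at houter
  refine houter.trans_eq (congrArg (fun k : ℝ≥0 => (k : ℝ≥0∞) * _) ?_)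
  simp only [neg_add, NNReal.rpow_add hl.ne']
  ring

lemma exists_mul_rpow_le (M : ℝ≥0) {ε : ℝ} (hε : 0 < ε) {δ : ℝ≥0} (hδ : 0 < δ) :
    ∃ l : ℝ≥0, 0 < l ∧ l < 1 ∧ M * l ^ ε ≤ δ := by
  have hlim : Filter.Tendsto (fun l : ℝ≥0 => M * l ^ ε) (nhds 0) (nhds 0) := by
    simpa only [NNReal.zero_rpow hε.ne', mul_zero] using
      ((NNReal.continuous_rpow_const hε.le).tendsto 0).const_mul M
  obtain ⟨l, hl0, hlδ, hl1⟩ := ((hlim.eventually_le_const hδ).and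
    (gt_mem_nhds one_pos)).exists_gt
  exact ⟨l, hl0, hl1, hlδ⟩

lemma IsIntervalSystem.isKParameter (H : IsIntervalSystem J I) (hA : IsWeight A α)
    (hB : IsWeight B β) (hC : IsWeight C γ) (hq : 0 < q) (hr : 0 < r) (hs : 0 < s)
    (hneg : (α + (1 / q).toReal) + (β + (1 / r).toReal) + (γ + (1 / s).toReal) < 0) :
    IsKParameter (nestedNorm J I s C r B q A) where
  isFunctionQuasinorm := H.isFunctionQuasinorm hA hB hC hq hr hs
  dilate_le δ hδ := by
    obtain ⟨M, hM⟩ := H.nestedNorm_dilate_le hA hB hC q r s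
    obtain ⟨l, hl0, hl1, hl⟩ := exists_mul_rpow_le M (neg_pos.2 hneg) hδ
    exact ⟨l, hl0, hl1, fun φ => (hM l hl0 hl1.le φ).trans (by gcongr)⟩

lemma IsIntervalSystem.isKParameter_wNorm (H : IsIntervalSystem J I) {a b c : ℝ → ℝ}
    (ha : IsSV a) (hb : IsSV b) (hc : IsSV c) (hq : 0 < q) (hr : 0 < r) (hs : 0 < s)
    (hα : α < 0) :
    IsKParameter fun φ => wNorm 0 s c
      (fun t => wNorm 0 r b (fun u => wNorm α q a φ (I t u)) (J t)) (Ioi 0) := by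
  have hε : 0 < -α / 4 := by linarith
  exact H.isKParameter (ha.isWeight (α - (1 / q).toReal) hε) (hb.isWeight (0 - (1 / r).toReal) hε)
    (hc.isWeight (0 - (1 / s).toReal) hε) hq hr hs (by linarith)

lemma IsIntervalSystem.wNorm_add_one (H : IsIntervalSystem J I) (α : ℝ) (s : ℝ≥0∞) (c : ℝ → ℝ)
    (r : ℝ≥0∞) (b : ℝ → ℝ) (q : ℝ≥0∞) (a : ℝ → ℝ) (φ : ℝ → ℝ≥0∞) :
    wNorm 0 s c (fun t => wNorm 0 r b (fun u => wNorm (α + 1) q a φ (I t u)) (J t)) (Ioi 0) =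
      wNorm 0 s c (fun t => wNorm 0 r b
        (fun u => wNorm α q a (fun v => ENNReal.ofReal v * φ v) (I t u)) (J t)) (Ioi 0) := by
  refine H.nestedNorm_congr fun t ht => ?_
  rw [← mul_assoc, ← ENNReal.ofReal_mul' ht.le, add_sub_right_comm, Real.rpow_add_one ht.ne']
  ring_nf

theorem isKParameter_normRL {a b c : ℝ → ℝ} (ha : IsSV a) (hb : IsSV b) (hc : IsSV c)
    (hq : 0 < q) (hr : 0 < r) (hs : 0 < s) (hα : α < 0) :
    IsKParameter (normRL α s c r b q a) :=
  isIntervalSystem_RL.isKParameter_wNorm ha hb hc hq hr hs hα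

theorem isKParameter_normLR {a b c : ℝ → ℝ} (ha : IsSV a) (hb : IsSV b) (hc : IsSV c)
    (hq : 0 < q) (hr : 0 < r) (hs : 0 < s) (hα : α < 0) :
    IsKParameter (normLR α s c r b q a) :=
  isIntervalSystem_LR.isKParameter_wNorm ha hb hc hq hr hs hα

lemma normRL_add_one (α : ℝ) (s : ℝ≥0∞) (c : ℝ → ℝ) (r : ℝ≥0∞) (b : ℝ → ℝ) (q : ℝ≥0∞)
    (a : ℝ → ℝ) (φ : ℝ → ℝ≥0∞) :
    normRL (α + 1) s c r b q a φ = normRL α s c r b q a (fun t => ENNReal.ofReal t * φ t) :=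
  isIntervalSystem_RL.wNorm_add_one α s c r b q a φ

lemma normLR_add_one (α : ℝ) (s : ℝ≥0∞) (c : ℝ → ℝ) (r : ℝ≥0∞) (b : ℝ → ℝ) (q : ℝ≥0∞)
    (a : ℝ → ℝ) (φ : ℝ → ℝ≥0∞) :
    normLR (α + 1) s c r b q a φ = normLR α s c r b q a (fun t => ENNReal.ofReal t * φ t) :=
  isIntervalSystem_LR.wNorm_add_one α s c r b q a φ

end NestedNorm

section Spaces

variable {V : Type*}

lemma Space.Embeds.trans {X Y Z : Space V} (hXY : X.Embeds Y) (hYZ : Y.Embeds Z) :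
    X.Embeds Z := by
  obtain ⟨hsub, C, hC⟩ := hXY
  obtain ⟨hsub', C', hC'⟩ := hYZ
  refine ⟨hsub.trans hsub', C' * C, fun f hf => ?_⟩
  calc Z.qnorm f ≤ C' * Y.qnorm f := hC' f (hsub hf)
    _ ≤ C' * (C * X.qnorm f) := by gcongr; exact hC f hf
    _ = (C' * C : ℝ≥0) * X.qnorm f := by rw [ENNReal.coe_mul, mul_assoc]

lemma Space.ofNorm_embeds {N N' : V → ℝ≥0∞} (C : ℝ≥0) (h : ∀ f, N' f ≤ C * N f) :
    (Space.ofNorm N).Embeds (Space.ofNorm N') :=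
  ⟨fun f hf => (h f).trans_lt (ENNReal.mul_lt_top ENNReal.coe_lt_top hf), C, fun f _ => h f⟩

variable [Add V] {A₀ A₁ B₀ : Space V}

/-- The space of all `f ∈ A₀ + A₁` with `Φ (K(·,f;A₀,A₁)) < ∞`, given by the real method with
parameter `Φ`. -/
noncomputable def kSpace (Φ : (ℝ → ℝ≥0∞) → ℝ≥0∞) (A₀ A₁ : Space V) : Space V where
  carrier := {f | f ∈ sumCarrier A₀ A₁ ∧ Φ (K A₀ A₁ f) < ∞}
  qnorm f := Φ (K A₀ A₁ f)

lemma K_le {f₀ f₁ : V} (h₀ : f₀ ∈ A₀.carrier) (h₁ : f₁ ∈ A₁.carrier) (t : ℝ) :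
    K A₀ A₁ (f₀ + f₁) t ≤ A₀.qnorm f₀ + ENNReal.ofReal t * A₁.qnorm f₁ :=
  iInf₂_le_of_le f₀ h₀ (iInf₂_le_of_le f₁ h₁ (iInf_le _ rfl))

lemma le_K {f : V} {t : ℝ} {x : ℝ≥0∞} (h : ∀ f₀ ∈ A₀.carrier, ∀ f₁ ∈ A₁.carrier,
    f = f₀ + f₁ → x ≤ A₀.qnorm f₀ + ENNReal.ofReal t * A₁.qnorm f₁) : x ≤ K A₀ A₁ f t :=
  le_iInf₂ fun f₀ h₀ => le_iInf₂ fun f₁ h₁ => le_iInf fun hf => h f₀ h₀ f₁ h₁ hf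

lemma K_anti_left (hsub : A₀.carrier ⊆ B₀.carrier)
    (hnorm : ∀ f ∈ A₀.carrier, B₀.qnorm f ≤ A₀.qnorm f) (f : V) (t : ℝ) :
    K B₀ A₁ f t ≤ K A₀ A₁ f t :=
  le_K fun f₀ h₀ f₁ h₁ hf => hf ▸ (K_le (hsub h₀) h₁ t).trans (by gcongr; exact hnorm f₀ h₀)

lemma K_eq_top {f : V} (hf : f ∉ sumCarrier A₀ A₁) : K A₀ A₁ f = fun _ => ∞ :=
  funext fun _ => top_le_iff.1 <| le_K fun f₀ h₀ f₁ h₁ h => (hf ⟨f₀, h₀, f₁, h₁, h⟩).elim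

lemma kSpace_eq_ofNorm {Φ : (ℝ → ℝ≥0∞) → ℝ≥0∞} (htop : Φ (fun _ => ∞) = ∞) (A₀ A₁ : Space V) :
    kSpace Φ A₀ A₁ = Space.ofNorm fun f => Φ (K A₀ A₁ f) := by
  refine congrArg (fun s => Space.mk s _) (Set.ext fun f => and_iff_right_of_imp fun hf => ?_)
  by_contra hsum
  rw [K_eq_top hsum, htop] at hf
  exact hf.ne rfl

end Spaces

section LayerCake

variable {X Y : Type*} [MeasurableSpace X] [MeasurableSpace Y] {μ : Measure X} {ν : Measure Y}

lemma lintegral_eq_lintegral_measure_ofReal_lt {g : X → ℝ≥0∞} (hg : Measurable g) :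
    ∫⁻ x, g x ∂μ = ∫⁻ l in Ioi (0 : ℝ), μ {x | ENNReal.ofReal l < g x} := by
  by_cases htop : μ {x | g x = ∞} = 0
  · have hfin : ∀ᵐ x ∂μ, g x ≠ ∞ := by simpa only [ae_iff, not_not, ne_eq] using htop
    calc ∫⁻ x, g x ∂μ = ∫⁻ x, ENNReal.ofReal (g x).toReal ∂μ :=
          lintegral_congr_ae <| hfin.mono fun x hx => (ENNReal.ofReal_toReal hx).symm
      _ = ∫⁻ l in Ioi (0 : ℝ), μ {x | l < (g x).toReal} :=
          lintegral_eq_lintegral_meas_lt μ (.of_forall fun _ => ENNReal.toReal_nonneg)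
            hg.ennreal_toReal.aemeasurable
      _ = ∫⁻ l in Ioi (0 : ℝ), μ {x | ENNReal.ofReal l < g x} :=
          setLIntegral_congr_fun measurableSet_Ioi fun l hl => measure_congr <|
            hfin.mono fun x hx => propext (ENNReal.ofReal_lt_iff_lt_toReal (le_of_lt hl) hx).symm
  · rw [lintegral_eq_top_of_measure_eq_top_ne_zero hg.aemeasurable htop]
    refine (top_le_iff.1 ?_).symm
    calc ∞ = ∫⁻ _ in Ioi (0 : ℝ), μ {x | g x = ∞} := by
          rw [setLIntegral_const, Real.volume_Ioi, ENNReal.mul_top htop]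
      _ ≤ ∫⁻ l in Ioi (0 : ℝ), μ {x | ENNReal.ofReal l < g x} :=
          lintegral_mono fun l => measure_mono fun x (hx : g x = ∞) =>
            show _ < g x from hx ▸ ENNReal.ofReal_lt_top

lemma lintegral_le_lintegral_of_measure_lt_le {g : X → ℝ≥0∞} {h : Y → ℝ≥0∞} (hg : Measurable g)
    (hh : Measurable h) (hle : ∀ l, μ {x | l < g x} ≤ ν {y | l < h y}) :
    ∫⁻ x, g x ∂μ ≤ ∫⁻ y, h y ∂ν := by
  rw [lintegral_eq_lintegral_measure_ofReal_lt hg, lintegral_eq_lintegral_measure_ofReal_lt hh]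
  exact lintegral_mono fun l => hle _

end LayerCake

section Rearrangement

variable {Ω : Type*} [MeasurableSpace Ω] {μ : Measure Ω} {𝕜 : Type*} [RCLike 𝕜]

lemma rearr_antitone (f : Ω →ₘ[μ] 𝕜) : Antitone (rearr f) := fun _ _ h =>
  sInf_le_sInf fun _ hl => le_trans hl (ENNReal.ofReal_le_ofReal h)

lemma measure_rearr_lt_le (f : Ω →ₘ[μ] 𝕜) (t : ℝ) :
    μ {x | rearr f t < ‖f x‖ₑ} ≤ ENNReal.ofReal t := by
  obtain ⟨u, hu, hlim, hmem⟩ := exists_seq_tendsto_sInf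
    (S := {l : ℝ≥0∞ | μ {x | l < ‖f x‖ₑ} ≤ ENNReal.ofReal t}) ⟨∞, by simp⟩ (OrderBot.bddBelow _)
  have hunion : {x | rearr f t < ‖f x‖ₑ} ⊆ ⋃ n, {x | u n < ‖f x‖ₑ} := fun x hx =>
    mem_iUnion.2 (hlim.eventually (gt_mem_nhds hx)).exists
  have hmono : Monotone fun n => {x | u n < ‖f x‖ₑ} := fun m n hmn x hx => (hu hmn).trans_lt hx
  exact (measure_mono hunion).trans (hmono.measure_iUnion ▸ iSup_le hmem)

lemma rearr_le_iff {f : Ω →ₘ[μ] 𝕜} {t : ℝ} {l : ℝ≥0∞} :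
    rearr f t ≤ l ↔ μ {x | l < ‖f x‖ₑ} ≤ ENNReal.ofReal t :=
  ⟨fun h => (measure_mono fun _ hx => h.trans_lt hx).trans (measure_rearr_lt_le f t),
    fun h => sInf_le h⟩

lemma lt_rearr_iff {f : Ω →ₘ[μ] 𝕜} {t : ℝ} {l : ℝ≥0∞} :
    l < rearr f t ↔ ENNReal.ofReal t < μ {x | l < ‖f x‖ₑ} :=
  lt_iff_lt_of_le_iff_le rearr_le_iff

lemma ofReal_mul_rearr_le_eLpNorm_one (f : Ω →ₘ[μ] 𝕜) (t : ℝ) :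
    ENNReal.ofReal t * rearr f t ≤ eLpNorm f 1 μ := by
  refine ENNReal.mul_le_of_forall_lt fun a ha l hl => ?_
  rw [eLpNorm_one_eq_lintegral_enorm, mul_comm]
  calc l * a ≤ l * μ {x | l ≤ ‖f x‖ₑ} := by
        gcongr
        exact (ha.trans (lt_rearr_iff.1 hl)).le.trans <|
          measure_mono fun x (hx : l < ‖f x‖ₑ) => show l ≤ ‖f x‖ₑ from hx.le
    _ ≤ ∫⁻ x, ‖f x‖ₑ ∂μ := mul_meas_ge_le_lintegral f.stronglyMeasurable.enorm l

lemma rearr_add_le (f g : Ω →ₘ[μ] 𝕜) (t : ℝ) :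
    rearr (f + g) t ≤ rearr f t + eLpNorm g ∞ μ := by
  rw [rearr_le_iff]
  refine le_trans (measure_mono_ae ?_) (measure_rearr_lt_le f t)
  filter_upwards [AEEqFun.coeFn_add f g, ae_le_eLpNormEssSup (f := g) (μ := μ)] with x hfg hg
  refine fun hlt => lt_of_not_ge fun hf => not_le_of_gt hlt ?_
  calc ‖(f + g) x‖ₑ ≤ ‖f x‖ₑ + ‖g x‖ₑ := hfg ▸ enorm_add_le _ _
    _ ≤ rearr f t + eLpNorm g ∞ μ := add_le_add hf (eLpNorm_exponent_top (f := g) ▸ hg)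

lemma ofReal_mul_rearr_le_lintegral (f : Ω →ₘ[μ] 𝕜) (t : ℝ) :
    ENNReal.ofReal t * rearr f t ≤ ∫⁻ u in Ioo 0 t, rearr f u :=
  calc ENNReal.ofReal t * rearr f t = ∫⁻ _ in Ioo 0 t, rearr f t := by
        rw [setLIntegral_const, Real.volume_Ioo, sub_zero, mul_comm]
    _ ≤ ∫⁻ u in Ioo 0 t, rearr f u :=
        setLIntegral_mono' measurableSet_Ioo fun u hu => rearr_antitone f hu.2.le

lemma ofReal_mul_maximal (f : Ω →ₘ[μ] 𝕜) {t : ℝ} (ht : 0 < t) :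
    ENNReal.ofReal t * maximal f t = ∫⁻ u in Ioo 0 t, rearr f u :=
  ENNReal.mul_inv_cancel_left (ENNReal.ofReal_pos.2 ht).ne' ENNReal.ofReal_ne_top

lemma setLIntegral_enorm_le_lintegral_rearr (f : Ω →ₘ[μ] 𝕜) {t : ℝ} {S : Set Ω}
    (hS : μ S ≤ ENNReal.ofReal t) : ∫⁻ x in S, ‖f x‖ₑ ∂μ ≤ ∫⁻ u in Ioo 0 t, rearr f u := by
  have hrearr : Measurable (rearr f) := (rearr_antitone f).measurable
  have henorm : Measurable fun x => ‖f x‖ₑ := f.stronglyMeasurable.enorm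
  refine lintegral_le_lintegral_of_measure_lt_le henorm hrearr fun l => ?_
  rw [Measure.restrict_apply (measurableSet_lt measurable_const henorm),
    Measure.restrict_apply (measurableSet_lt measurable_const hrearr)]
  set d := μ ({x | l < ‖f x‖ₑ} ∩ S)
  have hd : d ≤ ENNReal.ofReal t := (measure_mono inter_subset_right).trans hS
  have hdtop : d ≠ ∞ := ne_top_of_le_ne_top ENNReal.ofReal_ne_top hd
  have hsub : Ioo 0 d.toReal ⊆ {u | l < rearr f u} ∩ Ioo 0 t := fun u hu => by
    have hud : ENNReal.ofReal u < d := (ENNReal.ofReal_lt_iff_lt_toReal hu.1.le hdtop).2 hu.2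
    exact ⟨lt_rearr_iff.2 (hud.trans_le (measure_mono inter_subset_left)), hu.1,
      (ENNReal.ofReal_lt_ofReal_iff_of_nonneg hu.1.le).1 (hud.trans_le hd)⟩
  calc d = volume (Ioo 0 d.toReal) := by
        rw [Real.volume_Ioo, sub_zero, ENNReal.ofReal_toReal hdtop]
    _ ≤ volume ({u | l < rearr f u} ∩ Ioo 0 t) := measure_mono hsub

lemma K_L1_Linf_le (f : Ω →ₘ[μ] 𝕜) {t : ℝ} (ht : 0 < t) :
    K (L1 μ 𝕜) (Linf μ 𝕜) f t ≤ 2 * ∫⁻ u in Ioo 0 t, rearr f u := by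
  rcases eq_or_ne (∫⁻ u in Ioo 0 t, rearr f u) ∞ with htop | hfin
  · simp [htop]
  have hft : rearr f t ≠ ∞ := fun h => hfin <| top_le_iff.1 <| by
    simpa only [h, ENNReal.mul_top (ENNReal.ofReal_pos.2 ht).ne'] using
      ofReal_mul_rearr_le_lintegral f t
  set S := {x | rearr f t < ‖f x‖ₑ}
  have hS : MeasurableSet S := measurableSet_lt measurable_const f.stronglyMeasurable.enorm
  set f₀ := AEEqFun.mk (S.indicator f) (f.aestronglyMeasurable.indicator hS)
  set f₁ := AEEqFun.mk (Sᶜ.indicator f) (f.aestronglyMeasurable.indicator hS.compl)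
  have hsum : f₀ + f₁ = f := by
    rw [AEEqFun.mk_add_mk]
    simp only [indicator_self_add_compl, AEEqFun.mk_coeFn]
  have hf₀ : eLpNorm f₀ 1 μ ≤ ∫⁻ u in Ioo 0 t, rearr f u := by
    rw [eLpNorm_aeeqFun, eLpNorm_indicator_eq_eLpNorm_restrict hS, eLpNorm_one_eq_lintegral_enorm]
    exact setLIntegral_enorm_le_lintegral_rearr f (measure_rearr_lt_le f t)
  have hf₁ : eLpNorm f₁ ∞ μ ≤ rearr f t := by
    rw [eLpNorm_aeeqFun, eLpNorm_exponent_top]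
    refine essSup_le_of_ae_le _ (.of_forall fun x => ?_)
    change ‖Sᶜ.indicator f x‖ₑ ≤ rearr f t
    rw [enorm_indicator_eq_indicator_enorm]
    exact indicator_le' (fun x hx => not_lt.1 hx) (fun _ _ => zero_le) x
  calc K (L1 μ 𝕜) (Linf μ 𝕜) f t ≤ eLpNorm f₀ 1 μ + ENNReal.ofReal t * eLpNorm f₁ ∞ μ :=
        hsum ▸ K_le (hf₀.trans_lt hfin.lt_top) (hf₁.trans_lt hft.lt_top) t
    _ ≤ (∫⁻ u in Ioo 0 t, rearr f u) + ENNReal.ofReal t * rearr f t := by gcongr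
    _ ≤ (∫⁻ u in Ioo 0 t, rearr f u) + ∫⁻ u in Ioo 0 t, rearr f u := by
        gcongr
        exact ofReal_mul_rearr_le_lintegral f t
    _ = 2 * ∫⁻ u in Ioo 0 t, rearr f u := (two_mul _).symm

lemma weakL1_qnorm_le (f : Ω →ₘ[μ] 𝕜) : (weakL1 μ 𝕜).qnorm f ≤ (L1 μ 𝕜).qnorm f :=
  iSup₂_le fun t _ => ofReal_mul_rearr_le_eLpNorm_one f t

lemma K_weakL1_le_K_L1 (f : Ω →ₘ[μ] 𝕜) (t : ℝ) :
    K (weakL1 μ 𝕜) (Linf μ 𝕜) f t ≤ K (L1 μ 𝕜) (Linf μ 𝕜) f t :=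
  K_anti_left (fun g hg => (weakL1_qnorm_le g).trans_lt hg) (fun g _ => weakL1_qnorm_le g) f t

lemma ofReal_mul_rearr_le_K (f : Ω →ₘ[μ] 𝕜) {t : ℝ} (ht : 0 < t) :
    ENNReal.ofReal t * rearr f t ≤ K (weakL1 μ 𝕜) (Linf μ 𝕜) f t := by
  refine le_K fun f₀ _ f₁ _ hf => ?_
  calc ENNReal.ofReal t * rearr f t ≤ ENNReal.ofReal t * (rearr f₀ t + eLpNorm f₁ ∞ μ) :=
        mul_le_mul_right (hf ▸ rearr_add_le f₀ f₁ t) _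
    _ = ENNReal.ofReal t * rearr f₀ t + ENNReal.ofReal t * eLpNorm f₁ ∞ μ := mul_add _ _ _
    _ ≤ (weakL1 μ 𝕜).qnorm f₀ + ENNReal.ofReal t * (Linf μ 𝕜).qnorm f₁ :=
        add_le_add (le_iSup₂ (f := fun t (_ : t ∈ Ioi (0 : ℝ)) => ENNReal.ofReal t * rearr f₀ t)
          t ht) le_rfl

end Rearrangement

end LorentzKaramata

theorem theorem6p6_general {Φ : (ℝ → ℝ≥0∞) → ℝ≥0∞} (hΦ : IsKParameter Φ) {Ω : Type*}
    [MeasurableSpace Ω] (μ : Measure Ω) (𝕜 : Type*) [RCLike 𝕜] :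
    (kSpace Φ (L1 μ 𝕜) (Linf μ 𝕜)).Same (kSpace Φ (weakL1 μ 𝕜) (Linf μ 𝕜)) ∧
      (kSpace Φ (weakL1 μ 𝕜) (Linf μ 𝕜)).Same
        (Space.ofNorm fun f : Ω →ₘ[μ] 𝕜 => Φ fun t => ENNReal.ofReal t * maximal f t) ∧
      (Space.ofNorm fun f : Ω →ₘ[μ] 𝕜 => Φ fun t => ENNReal.ofReal t * maximal f t).Same
        (Space.ofNorm fun f : Ω →ₘ[μ] 𝕜 => Φ fun t => ENNReal.ofReal t * rearr f t) := by
  obtain ⟨_, hκ⟩ := hΦ.isFunctionQuasinorm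
  obtain ⟨C, hC⟩ := hΦ.hardy
  set dstar := Space.ofNorm fun f : Ω →ₘ[μ] 𝕜 => Φ fun t => ENNReal.ofReal t * maximal f t
  set star := Space.ofNorm fun f : Ω →ₘ[μ] 𝕜 => Φ fun t => ENNReal.ofReal t * rearr f t
  rw [kSpace_eq_ofNorm hκ.top, kSpace_eq_ofNorm hκ.top]
  set KL1 := Space.ofNorm fun f => Φ (K (L1 μ 𝕜) (Linf μ 𝕜) f)
  set KweakL1 := Space.ofNorm fun f => Φ (K (weakL1 μ 𝕜) (Linf μ 𝕜) f)
  have hL1_weakL1 : KL1.Embeds KweakL1 := Space.ofNorm_embeds 1 fun f =>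
    hκ.le_mul 1 _ _ fun t _ => (K_weakL1_le_K_L1 f t).trans_eq (one_mul _).symm
  have hweakL1_star : KweakL1.Embeds star := Space.ofNorm_embeds 1 fun f =>
    hκ.le_mul 1 _ _ fun t ht => (ofReal_mul_rearr_le_K f ht).trans_eq (one_mul _).symm
  have hstar_dstar : star.Embeds dstar := Space.ofNorm_embeds C fun f =>
    (hκ.mono fun t ht => (ofReal_mul_maximal f ht).le).trans (hC _ (rearr_antitone f))
  have hdstar_L1 : dstar.Embeds KL1 := Space.ofNorm_embeds 2 fun f =>
    hκ.le_mul 2 _ _ fun t ht => ofReal_mul_maximal f ht ▸ K_L1_Linf_le f ht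
  exact ⟨⟨hL1_weakL1, hweakL1_star.trans (hstar_dstar.trans hdstar_L1)⟩,
    ⟨hweakL1_star.trans hstar_dstar, hdstar_L1.trans hL1_weakL1⟩,
    ⟨hdstar_L1.trans (hL1_weakL1.trans hweakL1_star), hstar_dstar⟩⟩

theorem theorem6p6 {Ω : Type*} [MeasurableSpace Ω] (μ : Measure Ω) [SigmaFinite μ]
    (hμ : Nonatomic μ) (𝕜 : Type*) [RCLike 𝕜]
    (θ : ℝ) (hθ0 : 0 < θ) (hθ1 : θ ≤ 1)
    (p : ℝ≥0∞) (hp : p = 1 / ENNReal.ofReal (1 - θ))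
    (q r s : ℝ≥0∞) (hq : 0 < q) (hr : 0 < r) (hs : 0 < s)
    (a b c : ℝ → ℝ) (ha : IsSV a) (hb : IsSV b) (hc : IsSV c) :
    ((interpRL (L1 μ 𝕜) (Linf μ 𝕜) θ s c r b q a).Same
        (interpRL (weakL1 μ 𝕜) (Linf μ 𝕜) θ s c r b q a) ∧
      (interpRL (weakL1 μ 𝕜) (Linf μ 𝕜) θ s c r b q a).Same (dstarRL μ 𝕜 p s c r b q a) ∧
      (dstarRL μ 𝕜 p s c r b q a).Same (starRL μ 𝕜 p s c r b q a)) ∧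
    ((interpLR (L1 μ 𝕜) (Linf μ 𝕜) θ s c r b q a).Same
        (interpLR (weakL1 μ 𝕜) (Linf μ 𝕜) θ s c r b q a) ∧
      (interpLR (weakL1 μ 𝕜) (Linf μ 𝕜) θ s c r b q a).Same (dstarLR μ 𝕜 p s c r b q a) ∧
      (dstarLR μ 𝕜 p s c r b q a).Same (starLR μ 𝕜 p s c r b q a)) := by
  have hp' : (1 / p).toReal = -θ + 1 := by
    rw [hp, one_div, one_div, inv_inv, ENNReal.toReal_ofReal (by linarith)]
    ring
  simp only [dstarRL, starRL, dstarLR, starLR, hp', normRL_add_one, normLR_add_one]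
  exact ⟨theorem6p6_general (isKParameter_normRL ha hb hc hq hr hs (neg_lt_zero.2 hθ0)) μ 𝕜,
    theorem6p6_general (isKParameter_normLR ha hb hc hq hr hs (neg_lt_zero.2 hθ0)) μ 𝕜⟩
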